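/- Let $G$ be a group with a Garside structure $(G,P,\Delta)$ of finite type. That is: $P\subseteq G$ is a submonoid with $P\cap P^{-1}=\{1\}$ and $\Delta\in P$, such that (G1) the partial order $a\preccurlyeq b\Leftrightarrow a^{-1}b\in P$ on $G$ is a lattice order, with meet (greatest common divisor) denoted $\wedge$; (G2) the set of simple elements $[1,\Delta]=\{a\in G: 1\preccurlyeq a\preccurlyeq\Delta\}$ generates $G$; (G3) $\Delta^{-1}P\Delta=P$; (G4) for every $x\in P\setminus\{1\}$ the number of factors in the decompositions of $x$ as a product of elements of $P\setminus\{1\}$ is bounded; and (finite type) $[1,\Delta]$ is finite. For $x,c\in G$ write $x^c=c^{-1}xc$. Every $x\in G$ has a left normal form $x=\Delta^p x_1\cdots x_r$ with $p\in\mathbb Z$, $r\ge 0$, $x_i\in[1,\Delta]\setminus\{1,\Delta\}$ and $(x_i^{-1}\Delta)\wedge x_{i+1}=1$ for $1\le i<r$; put $\inf(x)=p$ (this is well defined if $\Delta\neq 1$; if $\Delta=1$ then $G$ is trivial, and the choice of $p$ does not matter below). Let $\iota(x)=x\Delta^{-\inf(x)}\wedge\Delta$, let $\mathfrak p(x)=\iota(x)\wedge\iota(x^{-1})$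 be the preferred prefix of $x$, and let $\mathfrak s(x)=x^{\mathfrak p(x)}$ be the cyclic sliding of $x$. The set of sliding circuits ${\rm SC}(x)$ is the set of all conjugates $y$ of $x$ in $G$ such that $\mathfrak s^m(y)=y$ for some $m\ge 1$. Proposition. Let $x,\alpha,\beta\in G$. If $x^\alpha\in{\rm SC}(x)$ and $x^\beta\in{\rm SC}(x)$, then $x^{\alpha\wedge\beta}\in{\rm SC}(x)$. -/

import Mathlib

/-- A Garside structure `(G, P, Δ)` on a group `G`: a submonoid `P` of positive elements with
`P ∩ P⁻¹ = {1}` and an element `Δ ∈ P` such that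
* the partial order `a ≼ b ↔ a⁻¹ * b ∈ P` is a lattice order (greatest common divisors and
  least common multiples of pairs exist),
* the simple elements, i.e. the `a` with `1 ≼ a ≼ Δ`, generate `G`,
* `Δ⁻¹ P Δ = P`,
* for every `x ∈ P \ {1}` the number of factors in decompositions of `x` as a product of
  elements of `P \ {1}` is bounded. -/
structure GarsideStructure (G : Type*) [Group G] where
  /-- The monoid `P` of positive elements. -/
  P : Submonoid G
  /-- The Garside element. -/
  Δ : G
  Δ_mem : Δ ∈ P
  eq_one_of_mem_of_inv_mem : ∀ a : G, a ∈ P → a⁻¹ ∈ P → a = 1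
  exists_gcd : ∀ a b : G, ∃ d : G, d⁻¹ * a ∈ P ∧ d⁻¹ * b ∈ P ∧
    ∀ c : G, c⁻¹ * a ∈ P → c⁻¹ * b ∈ P → c⁻¹ * d ∈ P
  exists_lcm : ∀ a b : G, ∃ m : G, a⁻¹ * m ∈ P ∧ b⁻¹ * m ∈ P ∧
    ∀ c : G, a⁻¹ * c ∈ P → b⁻¹ * c ∈ P → m⁻¹ * c ∈ P
  closure_simple : Subgroup.closure {a : G | a ∈ P ∧ a⁻¹ * Δ ∈ P} = ⊤
  conj_Δ_mem_iff : ∀ a : G, Δ⁻¹ * a * Δ ∈ P ↔ a ∈ P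
  bddAbove_length : ∀ x : G, x ∈ P → x ≠ 1 →
    BddAbove {k : ℕ | ∃ l : List G, (∀ a ∈ l, a ∈ P ∧ a ≠ 1) ∧ l.prod = x ∧ l.length = k}

namespace GarsideStructure

variable {G : Type*} [Group G] (S : GarsideStructure G)

/-- The prefix order `a ≼ b`. -/
def Prefix (a b : G) : Prop := a⁻¹ * b ∈ S.P

theorem prefix_antisymm {a b : G} (h : S.Prefix a b) (h' : S.Prefix b a) : a = b := by
  have h'' : (a⁻¹ * b)⁻¹ ∈ S.P := by simpa [Prefix] using h'
  exact inv_mul_eq_one.mp (S.eq_one_of_mem_of_inv_mem _ h h'')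

/-- `d` is a greatest common divisor of `a` and `b` with respect to `≼`. -/
def IsGcd (a b d : G) : Prop :=
  S.Prefix d a ∧ S.Prefix d b ∧ ∀ c : G, S.Prefix c a → S.Prefix c b → S.Prefix c d

theorem existsUnique_isGcd (a b : G) : ∃! d : G, S.IsGcd a b d := by
  obtain ⟨d, hd⟩ := S.exists_gcd a b
  have hd' : S.IsGcd a b d := hd
  exact ⟨d, hd', fun e he =>
    S.prefix_antisymm (hd'.2.2 e he.1 he.2.1) (he.2.2 d hd'.1 hd'.2.1)⟩

/-- The greatest common divisor `a ∧ b` with respect to `≼`. -/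
noncomputable def gcd (a b : G) : G := (S.existsUnique_isGcd a b).choose

theorem isGcd_gcd (a b : G) : S.IsGcd a b (S.gcd a b) :=
  (S.existsUnique_isGcd a b).choose_spec.1

/-- The set `[1, Δ]` of simple elements. -/
def simples : Set G := {a | S.Prefix 1 a ∧ S.Prefix a S.Δ}

/-- A Garside structure is of finite type if it has finitely many simple elements. -/
def FiniteType : Prop := S.simples.Finite

/-- The right complement `∂ s = s⁻¹ Δ`. -/
def rightCompl (s : G) : G := s⁻¹ * S.Δ

/-- For simple `a`, `b`: the decomposition `a · b` is left weighted. -/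
def LeftWeighted (a b : G) : Prop := S.gcd (S.rightCompl a) b = 1

/-- `x = Δ ^ p * x₁ * ⋯ * xᵣ`, with `l = [x₁, …, xᵣ]`, is the left normal form of `x`. -/
def IsLeftNormalForm (x : G) (p : ℤ) (l : List G) : Prop :=
  x = S.Δ ^ p * l.prod ∧ (∀ s ∈ l, s ∈ S.simples ∧ s ≠ 1 ∧ s ≠ S.Δ) ∧
    l.IsChain S.LeftWeighted

/-- The infimum of `x`: the exponent `p` of `Δ` in the left normal form of `x`. (The left normal
form always exists; it is unique unless `Δ = 1`, in which case `G` is trivial.) -/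
noncomputable def infimum (x : G) : ℤ :=
  Classical.epsilon fun p : ℤ => ∃ l : List G, S.IsLeftNormalForm x p l

/-- The initial factor `ι(x) = x Δ ^ (- inf x) ∧ Δ`. -/
noncomputable def initialFactor (x : G) : G := S.gcd (x * S.Δ ^ (-S.infimum x)) S.Δ

/-- The preferred prefix `𝔭(x) = ι(x) ∧ ι(x⁻¹)`. -/
noncomputable def preferredPrefix (x : G) : G :=
  S.gcd (S.initialFactor x) (S.initialFactor x⁻¹)

/-- The cyclic sliding `𝔰(x) = 𝔭(x)⁻¹ x 𝔭(x)`. -/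
noncomputable def cyclicSliding (x : G) : G :=
  (S.preferredPrefix x)⁻¹ * x * S.preferredPrefix x

/-- The set of sliding circuits `SC(x)`: the conjugates `y` of `x` such that `𝔰 ^ m (y) = y` for
some `m ≥ 1`. -/
def slidingCircuits (x : G) : Set G :=
  {y | IsConj x y ∧ ∃ m : ℕ, 1 ≤ m ∧ S.cyclicSliding^[m] y = y}

end GarsideStructure

/-!
Fix `x` and consider the elements `g` for which `xᵍ` has the same infimum `p` as `x` and its
inverse has the same infimum `p'` as `x⁻¹`. For such `g`,

  `g 𝔭(xᵍ) = x g Δ⁻ᵖ ∧ x⁻¹ g Δ⁻ᵖ' ∧ g Δ`.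

The right-hand side, `slide`, is a meet-preserving map of `g`, because left translations and right
multiplication by `Δ` are automorphisms of the lattice `(G, ≼)`. It commutes with right
multiplication by `Δ` and with left multiplication by elements that commute with `x`, and by
`cyclicSliding_conj` it lifts cyclic sliding to conjugating elements.

The conditions on the infima hold along circuits because an element that is periodic under
sliding has the largest infimum in its conjugacy class, and so does its inverse
(`infimum_conj_le_of_iterate_eq`). Indeed, suppose `x = yᵈ` with `inf y > inf x = p`. Up to a
factor `Δ`, `slide` based at `y` is `A ∧ B ∧ id` for the commuting automorphisms
`A g = y g Δ⁻ᵖ⁻¹` and `B g = y⁻¹ g Δ⁻ᵖ'⁻¹`. If `x` has canonical length at least two, then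
`g ≼ A (B g)` for all `g`, and `exists_iterate_inf_inf_id_le` shows that some iterate `e` of `d` satisfies
`e ≼ A e`, i.e. that the infimum grows along the orbit of `x`, which contradicts periodicity. If
the length is at most one, `A d ≼ d`, and finiteness of intervals gives the same conclusion.

To conclude, take `xᵅ` as the base point, so that `α = 1`, and let `n` be a common period of `x`
and `xᵝ`. The transport `T h = ζ⁻¹ slideⁿ h`, where `ζ = slideⁿ 1` commutes with `x`, preserves
meets, fixes `1` and all powers of `Δ`, and satisfies `𝔰ⁿ(xʰ) = x^(T h)`. On the set of
`h ∈ [Δ⁻ᵏ, Δᵏ]` with `xʰ = xᵝ`, which is finite, `T` is injective, so some power of `T` fixes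
`β`. That power also fixes `1 ∧ β`, so that `x^(1 ∧ β)` is periodic under sliding
(`exists_iterate_conj_gcd_one_eq`).
-/

/-! ### Iterating meets of maps on a semilattice -/

theorem exists_le_succ_of_antitone {L : Type*} [PartialOrder L] {f : ℕ → L} (hf : Antitone f)
    {s : Set L} (hs : s.Finite) (hfs : ∀ n, f n ∈ s) : ∃ n, f n ≤ f (n + 1) := by
  have : Finite s := hs
  obtain ⟨m, n, hmn, h⟩ := Finite.exists_ne_map_eq_of_infinite (fun n => (⟨f n, hfs n⟩ : s))
  have h' : f m = f n := congrArg Subtype.val h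
  rcases lt_or_gt_of_ne hmn with hlt | hlt
  · exact ⟨m, h'.le.trans (hf hlt)⟩
  · exact ⟨n, h'.ge.trans (hf hlt)⟩

section Semilattice

variable {L : Type*} [SemilatticeInf L]

theorem monotone_of_map_inf {A : L → L} (hA : ∀ a b, A (a ⊓ b) = A a ⊓ A b) : Monotone A := by
  intro a b h
  rw [← inf_eq_left, ← hA, inf_eq_left.2 h]

/-- Iterating `a ↦ A a ⊓ a` from `d` reaches an element `e ≤ A e`, as soon as
`[l, d]` is finite for some `l ≤ A l` below `d`: the iterates decrease and stay in `[l, d]`. -/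
theorem exists_iterate_inf_id_le {A : L → L} (hA : ∀ a b, A (a ⊓ b) = A a ⊓ A b) {l d : L}
    (hld : l ≤ d) (hl : l ≤ A l) (hfin : (Set.Icc l d).Finite) :
    ∃ n, (fun a => A a ⊓ a)^[n] d ≤ A ((fun a => A a ⊓ a)^[n] d) := by
  set E : L → L := fun a => A a ⊓ a
  have hanti : Antitone fun n => E^[n] d := by
    refine antitone_nat_of_succ_le fun n => ?_
    rw [Function.iterate_succ_apply']
    exact inf_le_right
  have hmem : ∀ n, l ≤ E^[n] d := by
    intro n
    induction n with
    | zero => exact hld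
    | succ n ih =>
      rw [Function.iterate_succ_apply']
      exact le_inf (hl.trans (monotone_of_map_inf hA ih)) ih
  obtain ⟨n, hn⟩ := exists_le_succ_of_antitone hanti hfin
    (fun n => ⟨hmem n, hanti (Nat.zero_le n)⟩)
  rw [Function.iterate_succ_apply'] at hn
  exact ⟨n, hn.trans inf_le_left⟩

theorem map_iterate_inf_inf {A B F : L → L} (hF : ∀ a b, F (a ⊓ b) = F a ⊓ F b)
    (hFA : ∀ a, F (A a) = A (F a)) (hFB : ∀ a, F (B a) = B (F a)) (n : ℕ) (a : L) :
    F ((fun a => A a ⊓ B a ⊓ a)^[n] a) = (fun a => A a ⊓ B a ⊓ a)^[n] (F a) :=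
  (Function.Semiconj.iterate_right
    (show Function.Semiconj F (fun a => A a ⊓ B a ⊓ a) (fun a => A a ⊓ B a ⊓ a) from
      fun a => by simp only [hF, hFA, hFB]) n) a

/-- For commuting meet-preserving maps `A` and `B` with `a ≤ A (B a)`, iterating
`a ↦ A a ⊓ B a ⊓ a` from `d` reaches an element `e ≤ A e`, as soon as `[l, d]` is finite for some
`l ≤ A l` below `d`. The iterates need not be bounded below, so they need not stabilize. -/
theorem exists_iterate_inf_inf_id_le {A B : L → L} (hA : ∀ a b, A (a ⊓ b) = A a ⊓ A b)
    (hB : ∀ a b, B (a ⊓ b) = B a ⊓ B b) (hcomm : ∀ a, A (B a) = B (A a))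
    (hAB : ∀ a, a ≤ A (B a)) {l d : L} (hld : l ≤ d) (hl : l ≤ A l)
    (hfin : (Set.Icc l d).Finite) :
    ∃ n, (fun a => A a ⊓ B a ⊓ a)^[n] d ≤ A ((fun a => A a ⊓ B a ⊓ a)^[n] d) := by
  obtain ⟨N, hN⟩ := exists_iterate_inf_id_le hA hld hl hfin
  refine ⟨N, ?_⟩
  set D : L → L := fun a => A a ⊓ B a ⊓ a with hD
  set E : L → L := fun a => A a ⊓ a
  have mA := monotone_of_map_inf hA
  have mB := monotone_of_map_inf hB
  have mD : Monotone D := fun a b h => inf_le_inf (inf_le_inf (mA h) (mB h)) h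
  have hDA : ∀ n a, D^[n] a ≤ A^[n] a := by
    intro n
    induction n with
    | zero => intro a; exact le_rfl
    | succ n ih =>
      intro a
      rw [Function.iterate_succ_apply', Function.iterate_succ_apply']
      exact (inf_le_left.trans inf_le_left).trans (mA (ih a))
  have hDanti : ∀ n a, D^[n + 1] a ≤ D^[n] a := by
    intro n a
    rw [Function.iterate_succ_apply']
    exact inf_le_right
  have hDE : ∀ n, D^[n] d ≤ E^[n] d := by
    intro n
    induction n with
    | zero => exact le_rfl
    | succ n ih =>
      rw [Function.iterate_succ_apply', Function.iterate_succ_apply']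
      exact inf_le_inf (inf_le_left.trans (mA ih)) ih
  have hEA : ∀ n, E^[n] d ≤ A^[n] d := by
    intro n
    induction n with
    | zero => exact le_rfl
    | succ n ih =>
      rw [Function.iterate_succ_apply', Function.iterate_succ_apply']
      exact inf_le_left.trans (mA ih)
  have hADcomm : ∀ n a, A (D^[n] a) = D^[n] (A a) :=
    fun n a => map_iterate_inf_inf hA (fun _ => rfl) hcomm n a
  have hDinf : ∀ a b, D (a ⊓ b) = D a ⊓ D b := fun a b => by
    simp only [hD, hA, hB]; ac_rfl
  -- The only obstruction to `D^[n] d ≤ A (D^[n] d)` is the pure power `A^[n + 1] d`.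
  have key : ∀ n, D^[n] d ⊓ A^[n + 1] d ≤ A (D^[n] d) := by
    intro n
    induction n with
    | zero => exact inf_le_right
    | succ n ih =>
      have h1 : D (D^[n] d) ⊓ D (A^[n + 1] d) ≤ A (D^[n + 1] d) := by
        rw [← hDinf]
        refine (mD ih).trans_eq ?_
        rw [hADcomm, hADcomm, Function.iterate_succ_apply']
      refine le_trans (le_inf ?_ ?_) h1
      · rw [← Function.iterate_succ_apply' D]
        exact inf_le_left
      · refine le_inf (le_inf ?_ ?_) ?_
        · rw [← Function.iterate_succ_apply' A]
          exact inf_le_right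
        · have h2 : A^[n] d ≤ B (A^[n + 1] d) := by
            rw [Function.iterate_succ_apply', ← hcomm]
            exact hAB _
          exact inf_le_left.trans ((hDanti n d).trans ((hDA n d).trans h2))
        · exact inf_le_left.trans (hDA (n + 1) d)
  have h3 : D^[N] d ≤ A^[N + 1] d := by
    rw [Function.iterate_succ_apply']
    exact (hDE N).trans (hN.trans (mA (hEA N)))
  exact (le_inf le_rfl h3).trans (key N)

end Semilattice

namespace GarsideStructure

variable {G : Type*} [Group G] (S : GarsideStructure G)

/-! ### The lattice order -/

theorem prefix_refl (a : G) : S.Prefix a a := by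
  simp [Prefix, S.P.one_mem]

variable {S} in
theorem Prefix.trans {a b c : G} (h : S.Prefix a b) (h' : S.Prefix b c) : S.Prefix a c := by
  have := S.P.mul_mem h h'
  simpa [Prefix, mul_assoc] using this

theorem prefix_mul_left_iff (c a b : G) : S.Prefix (c * a) (c * b) ↔ S.Prefix a b := by
  simp [Prefix, mul_assoc]

theorem prefix_mul_Δ_iff (a b : G) : S.Prefix (a * S.Δ) (b * S.Δ) ↔ S.Prefix a b := by
  have := S.conj_Δ_mem_iff (a⁻¹ * b)
  simpa [Prefix, mul_assoc] using this

theorem prefix_mul_zpow_iff (k : ℤ) (a b : G) :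
    S.Prefix (a * S.Δ ^ k) (b * S.Δ ^ k) ↔ S.Prefix a b := by
  induction k with
  | zero => simp
  | succ n ih => rw [zpow_add_one, ← mul_assoc, ← mul_assoc, prefix_mul_Δ_iff, ih]
  | pred n ih =>
    rw [← ih, ← prefix_mul_Δ_iff, mul_assoc, mul_assoc, ← zpow_add_one, sub_add_cancel]

theorem prefix_gcd_iff {a b c : G} :
    S.Prefix c (S.gcd a b) ↔ S.Prefix c a ∧ S.Prefix c b :=
  ⟨fun h => ⟨h.trans (S.isGcd_gcd a b).1, h.trans (S.isGcd_gcd a b).2.1⟩,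
    fun h => (S.isGcd_gcd a b).2.2 c h.1 h.2⟩

theorem gcd_prefix_left (a b : G) : S.Prefix (S.gcd a b) a := (S.isGcd_gcd a b).1

theorem gcd_prefix_right (a b : G) : S.Prefix (S.gcd a b) b := (S.isGcd_gcd a b).2.1

/-- The group ordered by `≼`, as a meet semilattice. -/
@[reducible] noncomputable def semilatticeInf : SemilatticeInf G where
  le := S.Prefix
  lt a b := S.Prefix a b ∧ ¬ S.Prefix b a
  le_refl := S.prefix_refl
  le_trans _ _ _ h h' := h.trans h'
  le_antisymm _ _ h h' := S.prefix_antisymm h h'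
  inf := S.gcd
  inf_le_left := S.gcd_prefix_left
  inf_le_right := S.gcd_prefix_right
  le_inf _ _ _ h h' := S.prefix_gcd_iff.2 ⟨h, h'⟩

theorem gcd_comm (a b : G) : S.gcd a b = S.gcd b a :=
  @inf_comm G S.semilatticeInf a b

theorem eq_gcd_of_forall {a b d : G}
    (h : ∀ c, S.Prefix c d ↔ S.Prefix c a ∧ S.Prefix c b) : d = S.gcd a b :=
  S.prefix_antisymm (S.prefix_gcd_iff.2 ((h d).1 (S.prefix_refl d)))
    ((h _).2 ⟨S.gcd_prefix_left a b, S.gcd_prefix_right a b⟩)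

theorem mul_gcd (c a b : G) : c * S.gcd a b = S.gcd (c * a) (c * b) := by
  refine S.eq_gcd_of_forall fun e => ?_
  obtain ⟨e, rfl⟩ : ∃ e', e = c * e' := ⟨c⁻¹ * e, (mul_inv_cancel_left _ _).symm⟩
  simp only [prefix_mul_left_iff, prefix_gcd_iff]

theorem gcd_mul_zpow (k : ℤ) (a b : G) :
    S.gcd a b * S.Δ ^ k = S.gcd (a * S.Δ ^ k) (b * S.Δ ^ k) := by
  refine S.eq_gcd_of_forall fun e => ?_
  obtain ⟨e, rfl⟩ : ∃ e', e = e' * S.Δ ^ k := ⟨e * (S.Δ ^ k)⁻¹, (inv_mul_cancel_right _ _).symm⟩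
  simp only [prefix_mul_zpow_iff, prefix_gcd_iff]

/-- The maps `g ↦ c g Δᵏ` preserve greatest common divisors. -/
theorem mul_gcd_mul_zpow (c : G) (k : ℤ) (a b : G) :
    c * S.gcd a b * S.Δ ^ k = S.gcd (c * a * S.Δ ^ k) (c * b * S.Δ ^ k) := by
  rw [mul_gcd, gcd_mul_zpow]

theorem mul_zpow_prefix_iff (k : ℤ) (a b : G) :
    S.Prefix (a * S.Δ ^ k) b ↔ S.Prefix a (b * S.Δ ^ (-k)) := by
  rw [← S.prefix_mul_zpow_iff k a, mul_assoc, ← zpow_add, neg_add_cancel, zpow_zero, mul_one]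

theorem one_prefix_iff (a : G) : S.Prefix 1 a ↔ a ∈ S.P := by simp [Prefix]

theorem prefix_mul_of_mem {a b : G} (h : b ∈ S.P) : S.Prefix a (a * b) := by
  simpa [Prefix] using h

theorem zpow_prefix_zpow {m n : ℤ} (h : m ≤ n) : S.Prefix (S.Δ ^ m) (S.Δ ^ n) := by
  obtain ⟨k, rfl⟩ := Int.exists_add_of_le h
  rw [Prefix, ← zpow_neg, ← zpow_add, neg_add_cancel_left, zpow_natCast]
  exact S.P.pow_mem S.Δ_mem k

theorem mul_zpow_prefix_mul_zpow (a : G) {m n : ℤ} (h : m ≤ n) :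
    S.Prefix (a * S.Δ ^ m) (a * S.Δ ^ n) :=
  (S.prefix_mul_left_iff a _ _).2 (S.zpow_prefix_zpow h)

theorem le_of_zpow_prefix_zpow (hΔ : S.Δ ≠ 1) {m n : ℤ} (h : S.Prefix (S.Δ ^ m) (S.Δ ^ n)) :
    m ≤ n := by
  by_contra! hlt
  have h1 : S.Prefix (S.Δ ^ (n + 1)) (S.Δ ^ n) := (S.zpow_prefix_zpow (by lia)).trans h
  have h2 := S.prefix_antisymm h1 (S.zpow_prefix_zpow (by lia))
  rw [zpow_add_one] at h2
  exact hΔ (mul_eq_left.1 h2)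

theorem prefix_Δ_mul {a : G} (h : a ∈ S.P) : S.Prefix S.Δ (a * S.Δ) := by
  have := (S.prefix_mul_Δ_iff 1 a).2 ((S.one_prefix_iff a).2 h)
  rwa [one_mul] at this

/-! ### Powers of the Garside element and finiteness of intervals -/

/-- Powers of `Δ` are cofinal in both directions. -/
theorem exists_zpow_prefix_prefix_zpow (a : G) :
    ∃ k : ℕ, S.Prefix (S.Δ ^ (-(k : ℤ))) a ∧ S.Prefix a (S.Δ ^ (k : ℤ)) := by
  have ha : a ∈ Subgroup.closure {a : G | a ∈ S.P ∧ a⁻¹ * S.Δ ∈ S.P} := by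
    rw [S.closure_simple]; trivial
  induction ha using Subgroup.closure_induction_left with
  | one =>
    exact ⟨0, by simpa using S.prefix_refl 1, by simpa using S.prefix_refl 1⟩
  | mul_left s hs y _ ih =>
    obtain ⟨k, h1, h2⟩ := ih
    have hs1 : S.Prefix 1 s := (S.one_prefix_iff s).2 hs.1
    have hs2 : S.Prefix s S.Δ := hs.2
    refine ⟨k + 1, ?_, ?_⟩
    · refine Prefix.trans ?_ ((S.prefix_mul_left_iff s _ _).2 h1)
      have := (S.prefix_mul_zpow_iff (-(k : ℤ)) _ _).2 hs1
      rw [one_mul] at this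
      exact (S.zpow_prefix_zpow (by push_cast; lia)).trans this
    · refine Prefix.trans ((S.prefix_mul_left_iff s _ _).2 h2) ?_
      have := (S.prefix_mul_zpow_iff (k : ℤ) _ _).2 hs2
      rwa [← zpow_one_add, add_comm] at this
  | inv_mul_cancel s hs y _ ih =>
    obtain ⟨k, h1, h2⟩ := ih
    have hs1 : S.Prefix s⁻¹ 1 := by simpa [Prefix] using hs.1
    have hsΔ : S.Prefix s S.Δ := hs.2
    have hs2 : S.Prefix (S.Δ ^ (-1 : ℤ)) s⁻¹ := by
      rw [← S.prefix_mul_zpow_iff 1, ← zpow_add, ← S.prefix_mul_left_iff s]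
      simpa using hsΔ
    refine ⟨k + 1, ?_, ?_⟩
    · refine Prefix.trans ?_ ((S.prefix_mul_left_iff s⁻¹ _ _).2 h1)
      have := (S.prefix_mul_zpow_iff (-(k : ℤ)) _ _).2 hs2
      rw [← zpow_add] at this
      convert this using 2
      push_cast; ring
    · refine Prefix.trans ((S.prefix_mul_left_iff s⁻¹ _ _).2 h2) ?_
      have := (S.prefix_mul_zpow_iff (k : ℤ) _ _).2 hs1
      rw [one_mul] at this
      exact this.trans (S.zpow_prefix_zpow (by push_cast; lia))

/-- `[1, Δᵏ⁺¹]` is finite because `a ↦ (a ∧ Δᵏ, (a ∧ Δᵏ)⁻¹ a)` embeds it into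
`[1, Δᵏ] × [1, Δ]`. -/
theorem FiniteType.finite_Icc_one_pow {S : GarsideStructure G} (hS : S.FiniteType) (k : ℕ) :
    {a : G | S.Prefix 1 a ∧ S.Prefix a (S.Δ ^ (k : ℤ))}.Finite := by
  induction k with
  | zero =>
    refine (Set.finite_singleton (1 : G)).subset fun a ha => ?_
    exact (S.prefix_antisymm ha.1 (by simpa using ha.2)).symm
  | succ k ih =>
    refine Set.Finite.subset (Set.Finite.image2 (fun a b : G => a * b) ih hS) ?_
    rintro a ⟨h1, h2⟩
    refine ⟨S.gcd a (S.Δ ^ (k : ℤ)), ⟨?_, S.gcd_prefix_right _ _⟩,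
      (S.gcd a (S.Δ ^ (k : ℤ)))⁻¹ * a, ⟨?_, ?_⟩, mul_inv_cancel_left _ _⟩
    · refine S.prefix_gcd_iff.2 ⟨h1, ?_⟩
      simpa using S.zpow_prefix_zpow (Int.natCast_nonneg k)
    · rw [one_prefix_iff]
      exact S.gcd_prefix_left _ _
    · rw [← S.prefix_mul_left_iff (S.gcd a (S.Δ ^ (k : ℤ))), mul_inv_cancel_left]
      have h3 := S.gcd_mul_zpow 1 a (S.Δ ^ (k : ℤ))
      rw [← zpow_add, zpow_one] at h3
      rw [h3]
      exact S.prefix_gcd_iff.2 ⟨S.prefix_mul_of_mem S.Δ_mem, by exact_mod_cast h2⟩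

theorem FiniteType.finite_Icc {S : GarsideStructure G} (hS : S.FiniteType) (a b : G) :
    {g : G | S.Prefix a g ∧ S.Prefix g b}.Finite := by
  obtain ⟨k, -, hk⟩ := S.exists_zpow_prefix_prefix_zpow (a⁻¹ * b)
  refine ((hS.finite_Icc_one_pow k).image (a * ·)).subset ?_
  rintro g ⟨h1, h2⟩
  refine ⟨a⁻¹ * g, ⟨?_, ?_⟩, mul_inv_cancel_left _ _⟩
  · exact (S.one_prefix_iff _).2 h1
  · exact ((S.prefix_mul_left_iff a⁻¹ _ _).2 h2).trans hk

theorem subsingleton_of_Δ_eq_one (hΔ : S.Δ = 1) : Subsingleton G := by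
  refine subsingleton_of_forall_eq 1 fun a => ?_
  obtain ⟨k, h1, h2⟩ := S.exists_zpow_prefix_prefix_zpow a
  rw [hΔ, one_zpow] at h1 h2
  exact S.prefix_antisymm h2 h1

/-! ### The infimum -/

/-- In a left normal form every divisor of the product that divides `Δ` divides the first
factor. -/
theorem prefix_head_of_isChain (s : G) (l : List G) (hs : ∀ t ∈ s :: l, t ∈ S.simples)
    (hl : (s :: l).IsChain S.LeftWeighted) {c : G} (h1 : S.Prefix c (s :: l).prod)
    (h2 : S.Prefix c S.Δ) : S.Prefix c s := by
  induction l generalizing s c with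
  | nil => simpa using h1
  | cons t l ih =>
    rw [List.isChain_cons_cons] at hl
    have hsΔ := (hs s (by simp)).2
    have hs1 := (hs s (by simp)).1
    have hw : (t :: l).prod ∈ S.P := S.P.list_prod_mem fun u hu =>
      (S.one_prefix_iff u).1 (hs u (List.mem_cons_of_mem _ hu)).1
    -- `e` is the gcd of the product with `Δ`; it has the form `s e'` with `e' ≼ s⁻¹ Δ`.
    set e := S.gcd (s :: t :: l).prod S.Δ
    have hse : S.Prefix s e := by
      refine S.prefix_gcd_iff.2 ⟨?_, hsΔ⟩
      rw [List.prod_cons]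
      exact S.prefix_mul_of_mem hw
    have h3 : S.Prefix (s⁻¹ * e) (t :: l).prod := by
      rw [← S.prefix_mul_left_iff s, mul_inv_cancel_left, ← List.prod_cons]
      exact S.gcd_prefix_left _ _
    have h4 : S.Prefix (s⁻¹ * e) (S.rightCompl s) :=
      (S.prefix_mul_left_iff s⁻¹ _ _).2 (S.gcd_prefix_right _ _)
    have h5 : S.Prefix (S.rightCompl s) S.Δ := by
      rw [rightCompl, ← S.prefix_mul_left_iff s, mul_inv_cancel_left]
      exact S.prefix_Δ_mul ((S.one_prefix_iff s).1 hs1)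
    have h6 : S.Prefix (s⁻¹ * e) t :=
      ih t (fun u hu => hs u (List.mem_cons_of_mem _ hu)) hl.2 h3 (h4.trans h5)
    have h7 : S.Prefix (s⁻¹ * e) 1 := by
      rw [← show S.gcd (S.rightCompl s) t = 1 from hl.1]
      exact S.prefix_gcd_iff.2 ⟨h4, h6⟩
    have h8 : S.Prefix e s := by
      rw [← S.prefix_mul_left_iff s⁻¹, inv_mul_cancel]
      exact h7
    exact (S.prefix_gcd_iff.2 ⟨h1, h2⟩).trans h8

theorem not_Δ_prefix_prod (hΔ : S.Δ ≠ 1) (l : List G)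
    (hl : ∀ s ∈ l, s ∈ S.simples ∧ s ≠ 1 ∧ s ≠ S.Δ) (hc : l.IsChain S.LeftWeighted) :
    ¬ S.Prefix S.Δ l.prod := by
  intro h
  cases l with
  | nil =>
    exact hΔ (S.prefix_antisymm h ((S.one_prefix_iff _).2 S.Δ_mem))
  | cons s l =>
    have h1 := S.prefix_head_of_isChain s l (fun t ht => (hl t ht).1) hc h (S.prefix_refl _)
    exact (hl s (by simp)).2.2 (S.prefix_antisymm (hl s (by simp)).1.2 h1)

theorem exists_leftNormalForm_of_prefix_pow (k : ℕ) (a : G) (h1 : S.Prefix 1 a)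
    (h2 : S.Prefix a (S.Δ ^ (k : ℤ))) (h3 : ¬ S.Prefix S.Δ a) :
    ∃ l, S.IsLeftNormalForm a 0 l := by
  induction k generalizing a with
  | zero =>
    refine ⟨[], ?_, by simp, by simp⟩
    simpa using S.prefix_antisymm (by simpa using h2) h1
  | succ k ih =>
    set s := S.gcd a S.Δ with hs
    have hsa : S.Prefix s a := S.gcd_prefix_left _ _
    have hs1 : S.Prefix 1 s := S.prefix_gcd_iff.2 ⟨h1, (S.one_prefix_iff _).2 S.Δ_mem⟩
    have hw1 : S.Prefix 1 (s⁻¹ * a) := (S.one_prefix_iff _).2 hsa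
    have hwk : S.Prefix (s⁻¹ * a) (S.Δ ^ (k : ℤ)) := by
      rw [← S.prefix_mul_left_iff s, mul_inv_cancel_left, hs, gcd_mul_zpow, ← zpow_one_add]
      refine S.prefix_gcd_iff.2 ⟨?_, by rw [add_comm]; exact_mod_cast h2⟩
      simpa using S.mul_zpow_prefix_mul_zpow a (Int.natCast_nonneg k)
    have hwΔ : ¬ S.Prefix S.Δ (s⁻¹ * a) := by
      intro h
      refine h3 ((S.prefix_Δ_mul ((S.one_prefix_iff s).1 hs1)).trans ?_)
      rw [← S.prefix_mul_left_iff s, mul_inv_cancel_left] at h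
      exact h
    obtain ⟨l, hl, hls, hlc⟩ := ih _ hw1 hwk hwΔ
    rw [zpow_zero, one_mul] at hl
    by_cases hs' : s = 1
    · exact ⟨l, by simpa [hs'] using hl, hls, hlc⟩
    · refine ⟨s :: l, ?_, ?_, ?_⟩
      · rw [zpow_zero, one_mul, List.prod_cons, ← hl, mul_inv_cancel_left]
      · intro t ht
        rcases List.mem_cons.1 ht with rfl | ht
        · exact ⟨⟨hs1, S.gcd_prefix_right _ _⟩, hs', fun h => h3 (h ▸ hsa)⟩
        · exact hls t ht
      · cases l with
        | nil => simp
        | cons t l =>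
          rw [List.isChain_cons_cons]
          refine ⟨?_, hlc⟩
          have hta : S.Prefix t (s⁻¹ * a) := by
            rw [hl, List.prod_cons]
            exact S.prefix_mul_of_mem (S.P.list_prod_mem fun u hu =>
              (S.one_prefix_iff u).1 (hls u (List.mem_cons_of_mem _ hu)).1.1)
          refine S.prefix_antisymm ?_ (S.prefix_gcd_iff.2 ⟨?_, (hls t (by simp)).1.1⟩)
          · rw [← S.prefix_mul_left_iff s, mul_one]
            refine S.prefix_gcd_iff.2 ⟨?_, ?_⟩
            · rw [← mul_inv_cancel_left s a, S.prefix_mul_left_iff]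
              exact (S.gcd_prefix_right _ _).trans hta
            · have := (S.prefix_mul_left_iff s _ _).2 (S.gcd_prefix_left (S.rightCompl s) t)
              rwa [rightCompl, mul_inv_cancel_left] at this
          · exact (S.one_prefix_iff _).2 (S.gcd_prefix_right _ _)

theorem exists_isLeftNormalForm (hΔ : S.Δ ≠ 1) (x : G) : ∃ p l, S.IsLeftNormalForm x p l := by
  obtain ⟨k, hk1, hk2⟩ := S.exists_zpow_prefix_prefix_zpow x
  obtain ⟨p, hp, hmax⟩ := Int.exists_greatest_of_bdd (P := fun p => S.Prefix (S.Δ ^ p) x)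
    ⟨k, fun z hz => S.le_of_zpow_prefix_zpow hΔ (Prefix.trans hz hk2)⟩ ⟨_, hk1⟩
  obtain ⟨m, -, hm⟩ := S.exists_zpow_prefix_prefix_zpow ((S.Δ ^ p)⁻¹ * x)
  obtain ⟨l, hl, hls, hlc⟩ := S.exists_leftNormalForm_of_prefix_pow m ((S.Δ ^ p)⁻¹ * x)
    ((S.one_prefix_iff _).2 hp) hm (by
      intro h
      rw [← S.prefix_mul_left_iff (S.Δ ^ p), mul_inv_cancel_left, ← zpow_add_one] at h
      have := hmax _ h
      lia)
  refine ⟨p, l, ?_, hls, hlc⟩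
  rw [zpow_zero, one_mul] at hl
  rw [← hl, mul_inv_cancel_left]

/-- The exponent of `Δ` in the left normal form is the largest `p` with `Δᵖ ≼ x`. -/
theorem zpow_prefix_iff_le_infimum (hΔ : S.Δ ≠ 1) (x : G) (n : ℤ) :
    S.Prefix (S.Δ ^ n) x ↔ n ≤ S.infimum x := by
  obtain ⟨l, hl, hls, hlc⟩ : ∃ l, S.IsLeftNormalForm x (S.infimum x) l :=
    Classical.epsilon_spec (S.exists_isLeftNormalForm hΔ x)
  have h1 : S.Prefix (S.Δ ^ S.infimum x) x := by
    have := S.prefix_mul_of_mem (a := S.Δ ^ S.infimum x) (S.P.list_prod_mem fun u hu =>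
      (S.one_prefix_iff u).1 (hls u hu).1.1)
    rwa [← hl] at this
  refine ⟨fun h => ?_, fun h => (S.zpow_prefix_zpow h).trans h1⟩
  by_contra! hlt
  have h2 : S.Prefix (S.Δ ^ (S.infimum x + 1)) x := (S.zpow_prefix_zpow (by lia)).trans h
  refine S.not_Δ_prefix_prod hΔ l hls hlc ?_
  rwa [zpow_add_one, ← S.prefix_mul_left_iff (S.Δ ^ S.infimum x)⁻¹, inv_mul_cancel_left,
    ← (eq_inv_mul_iff_mul_eq.2 hl.symm)] at h2

/-! ### Conjugation -/

theorem conj_eq_conj_iff {x g h : G} :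
    g⁻¹ * x * g = h⁻¹ * x * h ↔ (g * h⁻¹) * x = x * (g * h⁻¹) := by
  constructor
  · intro e
    have e' : g * (g⁻¹ * x * g) * h⁻¹ = g * (h⁻¹ * x * h) * h⁻¹ := by rw [e]
    simpa [mul_assoc] using e'.symm
  · intro e
    have e' : g⁻¹ * ((g * h⁻¹) * x) * h = g⁻¹ * (x * (g * h⁻¹)) * h := by rw [e]
    simpa [mul_assoc] using e'.symm

theorem zpow_prefix_conj_iff (x g : G) (n : ℤ) :
    S.Prefix (S.Δ ^ n) (g⁻¹ * x * g) ↔ S.Prefix (g * S.Δ ^ n) (x * g) := by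
  rw [← S.prefix_mul_left_iff g]
  simp only [mul_assoc, mul_inv_cancel_left]

/-! ### Cyclic sliding as a meet-preserving map on conjugating elements -/

/-- The map `g ↦ x g Δ⁻ᵖ ∧ x⁻¹ g Δ⁻ᵖ' ∧ g Δ`. If `p` and `p'` are the infima of `xᵍ` and of its
inverse, its value is `g 𝔭(xᵍ)`, so that it describes cyclic sliding on the level of
conjugating elements. -/
noncomputable def slide (x : G) (p p' : ℤ) (g : G) : G :=
  S.gcd (S.gcd (x * g * S.Δ ^ (-p)) (x⁻¹ * g * S.Δ ^ (-p'))) (g * S.Δ)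

theorem prefix_slide_iff {x : G} {p p' : ℤ} {g c : G} :
    S.Prefix c (S.slide x p p' g) ↔ S.Prefix c (x * g * S.Δ ^ (-p)) ∧
      S.Prefix c (x⁻¹ * g * S.Δ ^ (-p')) ∧ S.Prefix c (g * S.Δ) := by
  rw [slide, prefix_gcd_iff, prefix_gcd_iff, and_assoc]

theorem mul_slide (x : G) (p p' : ℤ) (c g : G) (hc : c * x = x * c) :
    c * S.slide x p p' g = S.slide x p p' (c * g) := by
  have hc' : c * x⁻¹ = x⁻¹ * c := (show Commute c x from hc).inv_right
  rw [slide, slide, mul_gcd, mul_gcd]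
  simp only [← mul_assoc, hc, hc']

theorem slide_mul_zpow (x : G) (p p' : ℤ) (g : G) (k : ℤ) :
    S.slide x p p' g * S.Δ ^ k = S.slide x p p' (g * S.Δ ^ k) := by
  simp only [slide, gcd_mul_zpow, mul_assoc, ← zpow_add, add_comm, ← zpow_add_one,
    ← zpow_one_add]

theorem slide_gcd (x : G) (p p' : ℤ) (g h : G) :
    S.slide x p p' (S.gcd g h) = S.gcd (S.slide x p p' g) (S.slide x p p' h) := by
  refine S.eq_gcd_of_forall fun c => ?_
  have h1 := S.mul_gcd_mul_zpow 1 1 g h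
  simp only [one_mul, zpow_one] at h1
  simp only [prefix_slide_iff, mul_gcd_mul_zpow, h1, prefix_gcd_iff]
  tauto

theorem iterate_map_gcd {f : G → G} (hf : ∀ a b, f (S.gcd a b) = S.gcd (f a) (f b)) (n : ℕ)
    (a b : G) : f^[n] (S.gcd a b) = S.gcd (f^[n] a) (f^[n] b) := by
  induction n with
  | zero => rfl
  | succ n ih => rw [Function.iterate_succ_apply', ih, hf]; simp only [Function.iterate_succ_apply']

theorem iterate_slide_gcd (x : G) (p p' : ℤ) (n : ℕ) (g h : G) :
    (S.slide x p p')^[n] (S.gcd g h) =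
      S.gcd ((S.slide x p p')^[n] g) ((S.slide x p p')^[n] h) :=
  S.iterate_map_gcd (S.slide_gcd x p p') n g h

theorem mul_iterate_slide (x : G) (p p' : ℤ) (n : ℕ) (c g : G) (hc : c * x = x * c) :
    c * (S.slide x p p')^[n] g = (S.slide x p p')^[n] (c * g) :=
  (Function.Semiconj.iterate_right (f := fun g => c * g)
    (fun g => S.mul_slide x p p' c g hc) n) g

theorem iterate_slide_mul_zpow (x : G) (p p' : ℤ) (n : ℕ) (g : G) (k : ℤ) :
    (S.slide x p p')^[n] g * S.Δ ^ k = (S.slide x p p')^[n] (g * S.Δ ^ k) :=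
  (Function.Semiconj.iterate_right (f := fun g => g * S.Δ ^ k)
    (fun g => S.slide_mul_zpow x p p' g k) n) g

theorem slide_mono {x : G} {p p' : ℤ} {g h : G} (hgh : S.Prefix g h) :
    S.Prefix (S.slide x p p' g) (S.slide x p p' h) := by
  let := S.semilatticeInf
  exact monotone_of_map_inf (S.slide_gcd x p p') hgh

/-- A lower bound `n` for the infimum of `yᵍ`, with `y` commuting with `x` (in practice `y = x` or
`y = x⁻¹`), is preserved when `g` is replaced by its image under `slide`. -/
theorem prefix_mul_slide {x y : G} {p p' n : ℤ} {g : G} (hy : y * x = x * y)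
    (h : S.Prefix (g * S.Δ ^ n) (y * g)) :
    S.Prefix (S.slide x p p' g * S.Δ ^ n) (y * S.slide x p p' g) := by
  rw [slide_mul_zpow, S.mul_slide _ _ _ _ _ hy]
  exact S.slide_mono h

theorem slide_one (x : G) :
    S.slide x (S.infimum x) (S.infimum x⁻¹) 1 = S.preferredPrefix x := by
  refine S.prefix_antisymm ?_ ?_
  · have h := S.prefix_slide_iff.1 (S.prefix_refl (S.slide x (S.infimum x) (S.infimum x⁻¹) 1))
    simp only [mul_one, one_mul] at h
    exact S.prefix_gcd_iff.2 ⟨S.prefix_gcd_iff.2 ⟨h.1, h.2.2⟩, S.prefix_gcd_iff.2 h.2⟩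
  · have h := S.prefix_refl (S.preferredPrefix x)
    simp only [preferredPrefix, initialFactor, prefix_gcd_iff] at h
    rw [prefix_slide_iff, mul_one, mul_one, one_mul]
    exact ⟨h.1.1, h.2.1, h.1.2⟩

theorem mul_slide_conj (x : G) (p p' : ℤ) (g : G) :
    g * S.slide (g⁻¹ * x * g) p p' 1 = S.slide x p p' g := by
  rw [slide, slide, mul_gcd, mul_gcd]
  simp only [mul_assoc, mul_inv_rev, inv_inv, mul_inv_cancel_left, one_mul]

theorem cyclicSliding_conj {x g : G} {p p' : ℤ} (hp : S.infimum (g⁻¹ * x * g) = p)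
    (hp' : S.infimum (g⁻¹ * x * g)⁻¹ = p') :
    S.cyclicSliding (g⁻¹ * x * g) = (S.slide x p p' g)⁻¹ * x * S.slide x p p' g := by
  rw [← mul_slide_conj, ← hp, ← hp', slide_one, cyclicSliding]
  group

theorem cyclicSliding_inv (x : G) : S.cyclicSliding x⁻¹ = (S.cyclicSliding x)⁻¹ := by
  simp only [cyclicSliding, preferredPrefix, inv_inv, S.gcd_comm (S.initialFactor x⁻¹)]
  group

theorem iterate_cyclicSliding_inv (n : ℕ) (x : G) :
    S.cyclicSliding^[n] x⁻¹ = (S.cyclicSliding^[n] x)⁻¹ :=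
  ((Function.Semiconj.iterate_right (f := fun x : G => x⁻¹)
    (fun x => (S.cyclicSliding_inv x).symm) n) x).symm

theorem infimum_le_infimum_cyclicSliding (hΔ : S.Δ ≠ 1) (x : G) :
    S.infimum x ≤ S.infimum (S.cyclicSliding x) := by
  rw [← S.zpow_prefix_iff_le_infimum hΔ, cyclicSliding, zpow_prefix_conj_iff, ← slide_one]
  refine S.prefix_mul_slide rfl ?_
  rw [one_mul, mul_one]
  exact (S.zpow_prefix_iff_le_infimum hΔ x _).2 le_rfl

theorem infimum_iterate_cyclicSliding (hΔ : S.Δ ≠ 1) {x : G} {m : ℕ} (hm : 1 ≤ m)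
    (hx : S.cyclicSliding^[m] x = x) (n : ℕ) :
    S.infimum (S.cyclicSliding^[n] x) = S.infimum x := by
  have hmono : Monotone fun n => S.infimum (S.cyclicSliding^[n] x) := by
    refine monotone_nat_of_le_succ fun n => ?_
    rw [Function.iterate_succ_apply']
    exact S.infimum_le_infimum_cyclicSliding hΔ _
  refine le_antisymm ?_ (hmono (Nat.zero_le n))
  have h1 : S.cyclicSliding^[m * n] x = x := (Function.IsPeriodicPt.mul_const hx n)
  calc S.infimum (S.cyclicSliding^[n] x) ≤ S.infimum (S.cyclicSliding^[m * n] x) :=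
        hmono (Nat.le_mul_of_pos_left n hm)
    _ = S.infimum x := by rw [h1]

/-! ### Periodic elements have extremal infimum and supremum -/

theorem iterate_cyclicSliding_conj {x g : G} {p p' : ℤ}
    (hp : ∀ n, S.infimum (S.cyclicSliding^[n] (g⁻¹ * x * g)) = p)
    (hp' : ∀ n, S.infimum (S.cyclicSliding^[n] (g⁻¹ * x * g))⁻¹ = p') (n : ℕ) :
    S.cyclicSliding^[n] (g⁻¹ * x * g) =
      ((S.slide x p p')^[n] g)⁻¹ * x * (S.slide x p p')^[n] g := by
  induction n with
  | zero => rfl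
  | succ n ih =>
    have h1 := hp n
    have h2 := hp' n
    rw [ih] at h1 h2
    rw [Function.iterate_succ_apply', Function.iterate_succ_apply', ih,
      S.cyclicSliding_conj h1 h2]

/-- An element that is periodic under cyclic sliding has the largest infimum in its conjugacy
class. If `y` has infimum at least `p + 1` and `yᵈ` has infimum `p`, the maps
`A g = y g Δ⁻ᵖ⁻¹` and `B g = y⁻¹ g Δ⁻ᵖ'⁻¹` satisfy `A (B g) = g Δ⁻ᵖ⁻ᵖ'⁻²`, and `A g ∧ B g ∧ g`
is `slide` followed by `Δ⁻¹`. When `yᵈ` has canonical length at least two, the order-theoretic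
lemma forces the infimum to grow along the orbit; when the length is at most one, `A d ≼ d`
and the finiteness of intervals suffices. -/
theorem infimum_conj_le_of_iterate_eq (hS : S.FiniteType) (hΔ : S.Δ ≠ 1) {x : G} {m : ℕ}
    (hm : 1 ≤ m) (hx : S.cyclicSliding^[m] x = x) (g : G) :
    S.infimum (g⁻¹ * x * g) ≤ S.infimum x := by
  let := S.semilatticeInf
  by_contra! hlt
  obtain ⟨y, hy⟩ : ∃ y, y = g⁻¹ * x * g := ⟨_, rfl⟩
  obtain ⟨d, hd⟩ : ∃ d, d = g⁻¹ := ⟨_, rfl⟩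
  have hxy : x = d⁻¹ * y * d := by rw [hy, hd]; group
  obtain ⟨p, hp⟩ : ∃ p, p = S.infimum x := ⟨_, rfl⟩
  obtain ⟨p', hp'⟩ : ∃ p', p' = S.infimum x⁻¹ := ⟨_, rfl⟩
  have hinf : ∀ n, S.infimum (S.cyclicSliding^[n] x) = p := fun n => by
    rw [S.infimum_iterate_cyclicSliding hΔ hm hx, hp]
  have hinf' : ∀ n, S.infimum (S.cyclicSliding^[n] x)⁻¹ = p' := fun n => by
    rw [← iterate_cyclicSliding_inv, S.infimum_iterate_cyclicSliding hΔ hm, hp']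
    rw [iterate_cyclicSliding_inv, hx]
  have hyp : S.Prefix (S.Δ ^ (p + 1)) y := by
    rw [S.zpow_prefix_iff_le_infimum hΔ, hy]; lia
  set A : G → G := fun h => y * h * S.Δ ^ (-(p + 1)) with hA
  set B : G → G := fun h => y⁻¹ * h * S.Δ ^ (-(p' + 1)) with hB
  have hAinf : ∀ a b, A (a ⊓ b) = A a ⊓ A b := S.mul_gcd_mul_zpow _ _
  have hBinf : ∀ a b, B (a ⊓ b) = B a ⊓ B b := S.mul_gcd_mul_zpow _ _
  have hABeq : ∀ h, A (B h) = h * S.Δ ^ (-(p' + 1) + -(p + 1)) := fun h => by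
    simp only [hA, hB, zpow_add]; group
  have hBAeq : ∀ h, B (A h) = h * S.Δ ^ (-(p' + 1) + -(p + 1)) := fun h => by
    rw [add_comm]; simp only [hA, hB, zpow_add]; group
  obtain ⟨k, hk, -⟩ := S.exists_zpow_prefix_prefix_zpow d
  obtain ⟨l, hl⟩ : ∃ l, l = S.Δ ^ (-(k : ℤ)) := ⟨_, rfl⟩
  have hld : l ≤ d := by rw [hl]; exact hk
  have hlA : l ≤ A l := by
    have h1 := (S.prefix_mul_zpow_iff (-(k : ℤ) + -(p + 1)) _ _).2 hyp
    rw [← zpow_add] at h1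
    have h2 : S.Δ ^ (p + 1 + (-(k : ℤ) + -(p + 1))) = l := by rw [hl]; congr 1; ring
    rw [h2, zpow_add, ← mul_assoc, ← hl] at h1
    exact h1
  have hfin : (Set.Icc l d).Finite := hS.finite_Icc l d
  by_cases hr : 2 ≤ -p + -p'
  · obtain ⟨N, hN⟩ := exists_iterate_inf_inf_id_le hAinf hBinf
      (fun a => (hABeq a).trans (hBAeq a).symm)
      (fun a => by
        rw [hABeq]
        have h1 := S.mul_zpow_prefix_mul_zpow a (show 0 ≤ -(p' + 1) + -(p + 1) by lia)
        rwa [zpow_zero, mul_one] at h1)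
      hld hlA hfin
    obtain ⟨E, hE⟩ : ∃ E : G → G, E = fun a => A a ⊓ B a ⊓ a := ⟨_, rfl⟩
    rw [← hE] at hN
    have hslide : ∀ h, S.slide y p p' h = E h * S.Δ ^ (1 : ℤ) := fun h => by
      rw [hE]
      change _ = S.gcd (S.gcd _ _) _ * _
      rw [gcd_mul_zpow, gcd_mul_zpow, mul_assoc (y * h), mul_assoc (y⁻¹ * h), ← zpow_add,
        ← zpow_add, neg_add, neg_add, neg_add_cancel_right, neg_add_cancel_right, zpow_one, slide]
    have hiter : ∀ n : ℕ, (S.slide y p p')^[n] d = E^[n] d * S.Δ ^ (n : ℤ) := by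
      intro n
      induction n with
      | zero => simp
      | succ n ih =>
        rw [Function.iterate_succ_apply', Function.iterate_succ_apply', ih, ← slide_mul_zpow,
          hslide, mul_assoc, ← zpow_add, add_comm]
        push_cast; rfl
    have horbit := S.iterate_cyclicSliding_conj (x := y) (g := d) (hxy ▸ hinf) (hxy ▸ hinf') N
    rw [← hxy, hiter] at horbit
    have hle : S.Prefix (S.Δ ^ (p + 1)) (S.cyclicSliding^[N] x) := by
      rw [horbit, zpow_prefix_conj_iff, mul_assoc, ← zpow_add, add_comm, zpow_add, ← mul_assoc,
        ← mul_assoc, prefix_mul_zpow_iff, mul_zpow_prefix_iff]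
      exact hN
    rw [S.zpow_prefix_iff_le_infimum hΔ, hinf] at hle
    lia
  · have hxle : A d ≤ d := by
      have h1 : S.Prefix (S.Δ ^ p') x⁻¹ := by rw [S.zpow_prefix_iff_le_infimum hΔ, hp']
      have h2 : S.Prefix (S.Δ ^ (-(p + 1))) (d⁻¹ * y⁻¹ * d) := by
        have h3 : d⁻¹ * y⁻¹ * d = x⁻¹ := by rw [hxy]; group
        rw [h3]
        exact Prefix.trans (S.zpow_prefix_zpow (by lia)) h1
      rw [zpow_prefix_conj_iff, ← S.prefix_mul_left_iff y, mul_inv_cancel_left,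
        ← mul_assoc] at h2
      exact h2
    obtain ⟨N, hN⟩ := exists_iterate_inf_id_le hAinf hld hlA hfin
    have hstep : ∀ n, A (A^[n] d) ≤ A^[n] d := by
      intro n
      induction n with
      | zero => exact hxle
      | succ n ih =>
        rw [Function.iterate_succ_apply']
        exact monotone_of_map_inf hAinf ih
    have hiter : ∀ n, (fun a => A a ⊓ a)^[n] d = A^[n] d := by
      intro n
      induction n with
      | zero => rfl
      | succ n ih =>
        rw [Function.iterate_succ_apply', Function.iterate_succ_apply', ih]
        exact inf_eq_left.2 (hstep n)
    rw [hiter] at hN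
    have hcancel : ∀ n, A^[n] d ≤ A (A^[n] d) → d ≤ A d := by
      intro n
      induction n with
      | zero => exact id
      | succ n ih =>
        rw [Function.iterate_succ_apply']
        intro h
        refine ih ?_
        exact (S.prefix_mul_left_iff y _ _).1 ((S.prefix_mul_zpow_iff _ _ _).1 h)
    have hle : S.Prefix (S.Δ ^ (p + 1)) x := by
      rw [hxy, zpow_prefix_conj_iff, mul_zpow_prefix_iff]
      exact hcancel N hN
    rw [S.zpow_prefix_iff_le_infimum hΔ] at hle
    lia

/-! ### Transport along a circuit -/

/-- The case `α = 1`, `Δ ≠ 1`. Let `n` be a common period of `x` and `xᵍ`. The map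
`h ↦ ζ⁻¹ slideⁿ h` with `ζ = slideⁿ 1` preserves meets, fixes `1`, and acts on the elements that
conjugate `x` to `xᵍ` by `h ↦ ζ⁻¹ h ζ'` for a fixed `ζ'`. It is injective there and preserves
intervals `[Δ⁻ᵏ, Δᵏ]`, which are finite, so that a power of it fixes `g`, hence also `1 ∧ g`. -/
theorem exists_iterate_conj_gcd_one_eq (hS : S.FiniteType) (hΔ : S.Δ ≠ 1) {x g : G} {m m' : ℕ}
    (hm : 1 ≤ m) (hx : S.cyclicSliding^[m] x = x) (hm' : 1 ≤ m')
    (hg : S.cyclicSliding^[m'] (g⁻¹ * x * g) = g⁻¹ * x * g) :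
    ∃ n, 1 ≤ n ∧ S.cyclicSliding^[n] ((S.gcd 1 g)⁻¹ * x * S.gcd 1 g) =
      (S.gcd 1 g)⁻¹ * x * S.gcd 1 g := by
  obtain ⟨n, hn, hxn, hgn⟩ : ∃ n, 1 ≤ n ∧ S.cyclicSliding^[n] x = x ∧
      S.cyclicSliding^[n] (g⁻¹ * x * g) = g⁻¹ * x * g :=
    ⟨m * m', Nat.mul_pos hm hm', Function.IsPeriodicPt.mul_const hx m',
      Function.IsPeriodicPt.const_mul hg m⟩
  obtain ⟨p, hp⟩ : ∃ p, p = S.infimum x := ⟨_, rfl⟩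
  obtain ⟨p', hp'⟩ : ∃ p', p' = S.infimum x⁻¹ := ⟨_, rfl⟩
  have hconjinv : ∀ h : G, (h⁻¹ * x * h)⁻¹ = h⁻¹ * x⁻¹ * h := fun h => by group
  have hmax : ∀ h, S.infimum (h⁻¹ * x * h) ≤ p := fun h =>
    hp ▸ S.infimum_conj_le_of_iterate_eq hS hΔ hm hx h
  have hmax' : ∀ h, S.infimum (h⁻¹ * x * h)⁻¹ ≤ p' := fun h => by
    rw [hconjinv, hp']
    exact S.infimum_conj_le_of_iterate_eq hS hΔ hm (by rw [iterate_cyclicSliding_inv, hx]) h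
  -- `good h` says that `xʰ` and its inverse have the same infima as `x` and its inverse.
  obtain ⟨good, hgood⟩ : ∃ good : G → Prop, ∀ h, good h ↔
      S.Prefix (h * S.Δ ^ p) (x * h) ∧ S.Prefix (h * S.Δ ^ p') (x⁻¹ * h) := ⟨_, fun _ => Iff.rfl⟩
  have hgood_iff : ∀ h, good h ↔
      S.infimum (h⁻¹ * x * h) = p ∧ S.infimum (h⁻¹ * x * h)⁻¹ = p' := fun h => by
    rw [hgood, ← zpow_prefix_conj_iff, ← zpow_prefix_conj_iff, S.zpow_prefix_iff_le_infimum hΔ,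
      S.zpow_prefix_iff_le_infimum hΔ, ← hconjinv]
    exact and_congr (hmax h).ge_iff_eq (hmax' h).ge_iff_eq
  obtain ⟨D, hD⟩ : ∃ D, D = S.slide x p p' := ⟨_, rfl⟩
  have hgoodD : ∀ h, good h → good (D h) := fun h hh => by
    rw [hgood] at hh ⊢
    rw [hD]
    exact ⟨S.prefix_mul_slide rfl hh.1, S.prefix_mul_slide (by group) hh.2⟩
  have horbit : ∀ h, good h → ∀ i : ℕ, good (D^[i] h) ∧
      S.cyclicSliding^[i] (h⁻¹ * x * h) = (D^[i] h)⁻¹ * x * D^[i] h := by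
    intro h hh i
    induction i with
    | zero => exact ⟨hh, rfl⟩
    | succ i ih =>
      rw [Function.iterate_succ_apply', Function.iterate_succ_apply', ih.2,
        S.cyclicSliding_conj ((hgood_iff _).1 ih.1).1 ((hgood_iff _).1 ih.1).2, ← hD]
      exact ⟨hgoodD _ ih.1, rfl⟩
  have hgood_one : good 1 := (hgood_iff 1).2 (by simp [hp, hp'])
  have hgood_g : good g := by
    rw [hgood_iff]
    refine ⟨le_antisymm (hmax g) ?_, le_antisymm (hmax' g) ?_⟩
    · have h1 := S.infimum_conj_le_of_iterate_eq hS hΔ hm' hg g⁻¹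
      rwa [show g⁻¹⁻¹ * (g⁻¹ * x * g) * g⁻¹ = x by group, ← hp] at h1
    · have h1 := S.infimum_conj_le_of_iterate_eq hS hΔ hm' (x := (g⁻¹ * x * g)⁻¹)
        (by rw [iterate_cyclicSliding_inv, hg]) g⁻¹
      rwa [show g⁻¹⁻¹ * (g⁻¹ * x * g)⁻¹ * g⁻¹ = x⁻¹ by group, ← hp'] at h1
  have hgood_gcd : ∀ a b, good a → good b → good (S.gcd a b) := fun a b ha hb => by
    rw [hgood] at ha hb ⊢
    simp only [gcd_mul_zpow, mul_gcd, prefix_gcd_iff]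
    exact ⟨⟨(S.gcd_prefix_left _ _).trans ha.1, (S.gcd_prefix_right _ _).trans hb.1⟩,
      (S.gcd_prefix_left _ _).trans ha.2, (S.gcd_prefix_right _ _).trans hb.2⟩
  have hDn_gcd : ∀ (i : ℕ) a b, D^[i] (S.gcd a b) = S.gcd (D^[i] a) (D^[i] b) :=
    hD ▸ S.iterate_slide_gcd x p p'
  have hDn_mul : ∀ (i : ℕ) c h, c * x = x * c → D^[i] (c * h) = c * D^[i] h :=
    fun i c h hc => by rw [hD, ← S.mul_iterate_slide x p p' i c h hc]
  have hDn_zpow : ∀ (i : ℕ) h (k : ℤ), D^[i] (h * S.Δ ^ k) = D^[i] h * S.Δ ^ k :=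
    fun i h k => by rw [hD, ← S.iterate_slide_mul_zpow]
  have hDn_mono : ∀ (i : ℕ) a b, S.Prefix a b → S.Prefix (D^[i] a) (D^[i] b) := by
    intro i a b hab
    let := S.semilatticeInf
    exact monotone_of_map_inf (hDn_gcd i) hab
  obtain ⟨ζ, hζ⟩ : ∃ ζ, ζ = D^[n] 1 := ⟨_, rfl⟩
  have hζx : ζ⁻¹ * x * ζ = x := by
    rw [hζ, ← (horbit 1 hgood_one n).2]
    simpa using hxn
  obtain ⟨T, hT⟩ : ∃ T : G → G, ∀ h, T h = ζ⁻¹ * D^[n] h := ⟨_, fun _ => rfl⟩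
  have hTconj : ∀ h, good h → S.cyclicSliding^[n] (h⁻¹ * x * h) = (T h)⁻¹ * x * T h := by
    intro h hh
    have hζ' : ζ * x * ζ⁻¹ = x := by
      nth_rewrite 1 [← hζx]
      group
    rw [(horbit h hh n).2, hT]
    nth_rewrite 1 [← hζ']
    group
  have hTgood : ∀ h, good h → good (T h) := by
    intro h hh
    rw [hgood_iff, ← hTconj h hh, (horbit h hh n).2, ← hgood_iff]
    exact (horbit h hh n).1
  have hTone : T 1 = 1 := by rw [hT, ← hζ, inv_mul_cancel]
  have hTgcd : ∀ a b, T (S.gcd a b) = S.gcd (T a) (T b) := fun a b => by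
    rw [hT, hT, hT, hDn_gcd, mul_gcd]
  have hTzpow : ∀ k : ℤ, T (S.Δ ^ k) = S.Δ ^ k := fun k => by
    have h1 := hDn_zpow n 1 k
    rw [one_mul, ← hζ] at h1
    rw [hT, h1, inv_mul_cancel_left]
  have hTmono : ∀ a b, S.Prefix a b → S.Prefix (T a) (T b) := fun a b hab => by
    rw [hT, hT, prefix_mul_left_iff]
    exact hDn_mono n a b hab
  obtain ⟨k, hk1, hk2⟩ := S.exists_zpow_prefix_prefix_zpow g
  obtain ⟨W, hW⟩ : ∃ W : Set G, ∀ h, h ∈ W ↔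
      (S.Prefix (S.Δ ^ (-(k : ℤ))) h ∧ S.Prefix h (S.Δ ^ (k : ℤ))) ∧
        h⁻¹ * x * h = g⁻¹ * x * g := ⟨{h | _}, fun _ => Iff.rfl⟩
  have hWfin : Finite W := (hS.finite_Icc _ _).subset fun h hh => ((hW h).1 hh).1
  have hTW : Set.MapsTo T W W := by
    intro h hh
    rw [hW] at hh ⊢
    have hgoodh : good h := by rw [hgood_iff, hh.2, ← hgood_iff]; exact hgood_g
    refine ⟨⟨?_, ?_⟩, ?_⟩
    · rw [← hTzpow]; exact hTmono _ _ hh.1.1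
    · rw [← hTzpow]; exact hTmono _ _ hh.1.2
    · rw [← hTconj h hgoodh, hh.2, hgn]
  have hTinj : Set.InjOn T W := by
    intro a ha b hb hab
    rw [hW] at ha hb
    have hc := conj_eq_conj_iff.1 (ha.2.trans hb.2.symm)
    have h1 := hDn_mul n (a * b⁻¹) b hc
    rw [inv_mul_cancel_right] at h1
    rw [hT, hT, mul_right_inj, h1, mul_eq_right, mul_inv_eq_one] at hab
    exact hab
  obtain ⟨N, hNpos, hN⟩ := (Set.MapsTo.restrict_inj hTW |>.2 hTinj).mem_periodicPts
    ⟨g, (hW g).2 ⟨⟨hk1, hk2⟩, rfl⟩⟩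
  have hNg : T^[N] g = g := by
    have h1 := congrArg Subtype.val hN
    rwa [Set.MapsTo.iterate_restrict] at h1
  have hfix : T^[N] (S.gcd 1 g) = S.gcd 1 g := by
    rw [S.iterate_map_gcd hTgcd, hNg, Function.iterate_fixed hTone]
  have hcirc : ∀ (i : ℕ) h, good h → good (T^[i] h) ∧
      (S.cyclicSliding^[n])^[i] (h⁻¹ * x * h) = (T^[i] h)⁻¹ * x * T^[i] h := by
    intro i h hh
    induction i with
    | zero => exact ⟨hh, rfl⟩
    | succ i ih =>
      rw [Function.iterate_succ_apply', Function.iterate_succ_apply', ih.2]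
      exact ⟨hTgood _ ih.1, hTconj _ ih.1⟩
  refine ⟨n * N, Nat.mul_pos hn hNpos, ?_⟩
  rw [Function.iterate_mul, (hcirc N _ (hgood_gcd _ _ hgood_one hgood_g)).2, hfix]

end GarsideStructure

theorem mainTheorem5 {G : Type*} [Group G] (S : GarsideStructure G) (hS : S.FiniteType)
    (x α β : G) (hα : α⁻¹ * x * α ∈ S.slidingCircuits x)
    (hβ : β⁻¹ * x * β ∈ S.slidingCircuits x) :
    (S.gcd α β)⁻¹ * x * S.gcd α β ∈ S.slidingCircuits x := by
  obtain ⟨-, m, hm, hαm⟩ := hα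
  obtain ⟨-, m', hm', hβm'⟩ := hβ
  refine ⟨isConj_iff.2 ⟨(S.gcd α β)⁻¹, by rw [inv_inv]⟩, ?_⟩
  by_cases hΔ : S.Δ = 1
  · have := S.subsingleton_of_Δ_eq_one hΔ
    exact ⟨1, le_rfl, Subsingleton.elim _ _⟩
  -- Take `x^α` as the base point: it is conjugated to `x^β` by `α⁻¹ β`.
  have hβ' : (α⁻¹ * β)⁻¹ * (α⁻¹ * x * α) * (α⁻¹ * β) = β⁻¹ * x * β := by group
  have hgcd : S.gcd α β = α * S.gcd 1 (α⁻¹ * β) := by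
    rw [S.mul_gcd, mul_one, mul_inv_cancel_left]
  have h := S.exists_iterate_conj_gcd_one_eq hS hΔ hm hαm hm' (g := α⁻¹ * β) (by rw [hβ', hβm'])
  have hconj : (S.gcd α β)⁻¹ * x * S.gcd α β =
      (S.gcd 1 (α⁻¹ * β))⁻¹ * (α⁻¹ * x * α) * S.gcd 1 (α⁻¹ * β) := by
    rw [hgcd]; group
  rwa [hconj]
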